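/- A (real, associative, not necessarily unital) algebra $A$ that is also a vector lattice is called an $f$-algebra if $ab\ge 0$ whenever $a,b\ge 0$, and $a\wedge b=0$ implies $(ac)\wedge b=(ca)\wedge b=0$ for all $0\le c\in A$; it is semiprime if $a^2=0$ implies $a=0$. Let $\mathrm{Orth}(A)$ denote the orthomorphisms of $A$, that is, the order bounded linear maps $S:A\to A$ such that $|x|\wedge|y|=0$ implies $|Sx|\wedge |y|=0$, ordered by $S\le R$ iff $Sx\le Rx$ for all $x\ge 0$, and let $I_A\in\mathrm{Orth}(A)$ be the identity. An Archimedean semiprime $f$-algebra $A$ is identified with a subset of $\mathrm{Orth}(A)$ through $a\mapsto\pi_a$, $\pi_a(b)=ab$, so that $A\cap[0,I_A]=\{a\in A: 0\le\pi_a\le I_A\}$. A linear operator $T:A\to B$ between Archimedean semiprime $f$-algebras is contractive if it is positive and $T(a)\in B\cap[0,I_B]$ for all $a\in A\cap[0,I_A]$. A vector lattice $B$ is relatively uniformly complete if for every $0\le u\in B$ and every sequence $(x_n)$ in $B$ that is $u$-uniformly Cauchy (for each $\varepsilon>0$ there is $N$ with $|x_m-x_n|\le\varepsilon u$ for all $m,n\ge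 N$) there is $x\in B$ to which it converges $u$-uniformly (for each $\varepsilon>0$ there is $N$ with $|x_n-x|\le\varepsilon u$ for all $n\ge N$). **Proposition 3.7.** Let $A$ and $B$ be Archimedean semiprime $f$-algebras such that $B$ is relatively uniformly complete, and let $T:A\to B$ be a positive linear operator. Then $T$ is contractive and is an extreme point of the (convex) set of all contractive operators from $A$ to $B$ if and only if $T$ is an algebra homomorphism, i.e. $T(ab)=T(a)T(b)$ for all $a,b\in A$. -/

import Mathlib

/-! Vector lattices (Riesz spaces) are `[AddCommGroup A] [Module ℝ A] [Lattice A]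
[IsOrderedAddMonoid A] [IsOrderedModule ℝ A]`; real (associative, not necessarily unital)
algebras are `[NonUnitalRing A] [Module ℝ A] [IsScalarTower ℝ A A] [SMulCommClass ℝ A A]`. -/

namespace FAlg

/-- A vector lattice is Archimedean if `n a ≤ b` for all `n` (with `a, b ≥ 0`) forces `a = 0`.
(Mathlib's `Archimedean` is a different notion, meant for linear orders.) -/
def IsArchimedean (A : Type*) [AddCommGroup A] [Lattice A] : Prop :=
  ∀ a b : A, 0 ≤ a → 0 ≤ b → (∀ n : ℕ, n • a ≤ b) → a = 0

/-- `x n` is a Cauchy sequence relatively uniformly with respect to the regulator `u`. -/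
def IsRUCauchy {A : Type*} [AddCommGroup A] [Module ℝ A] [Lattice A]
    (u : A) (x : ℕ → A) : Prop :=
  ∀ ε : ℝ, 0 < ε → ∃ N : ℕ, ∀ m ≥ N, ∀ n ≥ N, |x m - x n| ≤ ε • u

/-- `x n` converges to `l` relatively uniformly with respect to the regulator `u`. -/
def RUTendsto {A : Type*} [AddCommGroup A] [Module ℝ A] [Lattice A]
    (u : A) (x : ℕ → A) (l : A) : Prop :=
  ∀ ε : ℝ, 0 < ε → ∃ N : ℕ, ∀ n ≥ N, |x n - l| ≤ ε • u

/-- Relative uniform completeness: for every regulator `u ≥ 0`, every `u`-uniformly Cauchy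
sequence is `u`-uniformly convergent. -/
def IsRUComplete (A : Type*) [AddCommGroup A] [Module ℝ A] [Lattice A] : Prop :=
  ∀ u : A, 0 ≤ u → ∀ x : ℕ → A, IsRUCauchy u x → ∃ l : A, RUTendsto u x l

/-- The lattice-ordered algebra `A` is an `f`-algebra. -/
class IsFAlgebra (A : Type*) [NonUnitalRing A] [Lattice A] : Prop where
  mul_nonneg' : ∀ a b : A, 0 ≤ a → 0 ≤ b → 0 ≤ a * b
  mul_right_inf : ∀ a b c : A, a ⊓ b = 0 → 0 ≤ c → (a * c) ⊓ b = 0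
  mul_left_inf : ∀ a b c : A, a ⊓ b = 0 → 0 ≤ c → (c * a) ⊓ b = 0

/-- Semiprime: zero is the only nilpotent element, i.e. `a² = 0` implies `a = 0`. -/
def IsSemiprime (A : Type*) [NonUnitalRing A] : Prop :=
  ∀ a : A, a * a = 0 → a = 0

/-- An orthomorphism: an order bounded linear operator `S` on `A` such that `x ⊥ y` implies
`S x ⊥ y`. -/
structure IsOrthomorphism {A : Type*} [AddCommGroup A] [Module ℝ A] [Lattice A]
    (S : A →ₗ[ℝ] A) : Prop where
  bddAbove : ∀ u v : A, BddAbove (S '' Set.Icc u v)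
  bddBelow : ∀ u v : A, BddBelow (S '' Set.Icc u v)
  disjoint : ∀ x y : A, |x| ⊓ |y| = 0 → |S x| ⊓ |y| = 0

/-- `Orth A`, the set of orthomorphisms of `A`. -/
def Orth (A : Type*) [AddCommGroup A] [Module ℝ A] [Lattice A] : Type _ :=
  {S : A →ₗ[ℝ] A // IsOrthomorphism S}

namespace Orth

section Order

variable {A : Type*} [AddCommGroup A] [Module ℝ A] [Lattice A] [IsOrderedAddMonoid A]

/-- The operator order on `Orth A`: `S ≤ R` iff `S x ≤ R x` for all `x ≥ 0`. -/
instance : PartialOrder (Orth A) where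
  le S R := ∀ x : A, 0 ≤ x → S.1 x ≤ R.1 x
  le_refl _ _ _ := le_rfl
  le_trans _ _ _ h₁ h₂ x hx := (h₁ x hx).trans (h₂ x hx)
  le_antisymm S R h₁ h₂ := by
    refine Subtype.ext (LinearMap.ext fun x => ?_)
    have key : ∀ y : A, 0 ≤ y → S.1 y = R.1 y := fun y hy => le_antisymm (h₁ y hy) (h₂ y hy)
    rw [← posPart_sub_negPart x, map_sub, map_sub, key _ (posPart_nonneg x),
      key _ (negPart_nonneg x)]

/-- The zero operator. -/
instance : Zero (Orth A) :=
  ⟨⟨0, ⟨fun _ _ => ⟨0, by rintro _ ⟨x, -, rfl⟩; simp⟩,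
    fun _ _ => ⟨0, by rintro _ ⟨x, -, rfl⟩; simp⟩, fun x y _ => by simp⟩⟩⟩

/-- The identity operator `I`. -/
instance : One (Orth A) :=
  ⟨⟨LinearMap.id, ⟨fun u v => ⟨v, by rintro _ ⟨x, hx, rfl⟩; exact hx.2⟩,
    fun u v => ⟨u, by rintro _ ⟨x, hx, rfl⟩; exact hx.1⟩, fun x y h => h⟩⟩⟩

end Order

end Orth

section Mul

variable {A : Type*} [NonUnitalRing A] [Lattice A] [IsOrderedAddMonoid A] [IsFAlgebra A]

theorem mul_le_mul_left_of_nonneg {c x y : A} (hc : 0 ≤ c) (h : x ≤ y) : c * x ≤ c * y := by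
  have := IsFAlgebra.mul_nonneg' c (y - x) hc (sub_nonneg.2 h)
  rwa [mul_sub, sub_nonneg] at this

theorem abs_mul_le_abs_mul_abs (a x : A) : |a * x| ≤ |a| * |x| := by
  have hp := posPart_nonneg a
  have hn := negPart_nonneg a
  have hq := posPart_nonneg x
  have hm := negPart_nonneg x
  have h1 := IsFAlgebra.mul_nonneg' _ _ hp hq
  have h2 := IsFAlgebra.mul_nonneg' _ _ hp hm
  have h3 := IsFAlgebra.mul_nonneg' _ _ hn hq
  have h4 := IsFAlgebra.mul_nonneg' _ _ hn hm
  have e : a * x = (a⁺ - a⁻) * (x⁺ - x⁻) := by rw [posPart_sub_negPart, posPart_sub_negPart]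
  rw [← posPart_add_negPart a, ← posPart_add_negPart x, e]
  refine abs_le'.2 ⟨?_, ?_⟩
  · rw [← sub_nonneg]
    have : (a⁺ + a⁻) * (x⁺ + x⁻) - (a⁺ - a⁻) * (x⁺ - x⁻)
        = a⁺ * x⁻ + a⁺ * x⁻ + (a⁻ * x⁺ + a⁻ * x⁺) := by noncomm_ring
    rw [this]
    exact add_nonneg (add_nonneg h2 h2) (add_nonneg h3 h3)
  · rw [← sub_nonneg]
    have : (a⁺ + a⁻) * (x⁺ + x⁻) - -((a⁺ - a⁻) * (x⁺ - x⁻))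
        = a⁺ * x⁺ + a⁺ * x⁺ + (a⁻ * x⁻ + a⁻ * x⁻) := by noncomm_ring
    rw [this]
    exact add_nonneg (add_nonneg h1 h1) (add_nonneg h4 h4)

variable [Module ℝ A] [SMulCommClass ℝ A A]

theorem isOrthomorphism_mulLeft (a : A) : IsOrthomorphism (LinearMap.mulLeft ℝ a) where
  bddAbove u v := by
    refine ⟨a⁺ * v - a⁻ * u, ?_⟩
    rintro _ ⟨x, hx, rfl⟩
    have e : LinearMap.mulLeft ℝ a x = a⁺ * x - a⁻ * x := by
      rw [← sub_mul, posPart_sub_negPart, LinearMap.mulLeft_apply]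
    rw [e]
    exact sub_le_sub (mul_le_mul_left_of_nonneg (posPart_nonneg a) hx.2)
      (mul_le_mul_left_of_nonneg (negPart_nonneg a) hx.1)
  bddBelow u v := by
    refine ⟨a⁺ * u - a⁻ * v, ?_⟩
    rintro _ ⟨x, hx, rfl⟩
    have e : LinearMap.mulLeft ℝ a x = a⁺ * x - a⁻ * x := by
      rw [← sub_mul, posPart_sub_negPart, LinearMap.mulLeft_apply]
    rw [e]
    exact sub_le_sub (mul_le_mul_left_of_nonneg (posPart_nonneg a) hx.1)
      (mul_le_mul_left_of_nonneg (negPart_nonneg a) hx.2)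
  disjoint x y h := by
    rw [LinearMap.mulLeft_apply]
    refine le_antisymm ?_ (le_inf (abs_nonneg _) (abs_nonneg _))
    calc |a * x| ⊓ |y| ≤ (|a| * |x|) ⊓ |y| := inf_le_inf_right _ (abs_mul_le_abs_mul_abs a x)
      _ = 0 := IsFAlgebra.mul_left_inf _ _ _ h (abs_nonneg a)

/-- The map `π : A → Orth A`, `π a = (b ↦ a b)`, along which `A` is identified with a subset
of `Orth A`. -/
def toOrth (a : A) : Orth A := ⟨LinearMap.mulLeft ℝ a, isOrthomorphism_mulLeft a⟩

end Mul

/-- The contractive operators `A → B`: positive linear operators that map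
`A ∩ [0, I]` into `B ∩ [0, I]`, the order intervals being taken in `Orth A` and `Orth B`. -/
def contractiveOperators (A B : Type*)
    [NonUnitalRing A] [Module ℝ A] [SMulCommClass ℝ A A] [Lattice A]
    [IsOrderedAddMonoid A] [IsFAlgebra A]
    [NonUnitalRing B] [Module ℝ B] [SMulCommClass ℝ B B] [Lattice B]
    [IsOrderedAddMonoid B] [IsFAlgebra B] : Set (A →ₗ[ℝ] B) :=
  {T | (∀ a : A, 0 ≤ a → 0 ≤ T a) ∧
    ∀ a : A, toOrth a ∈ Set.Icc (0 : Orth A) 1 → toOrth (T a) ∈ Set.Icc (0 : Orth B) 1}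

end FAlg

namespace FAlg

/-! Write `[0, I]` for the `a ≥ 0` with `a² ≤ a`; by semiprimeness these are exactly the `a` with `0
≤ π_a ≤ I`. It is large: `r⁻² (2ra - a²)⁺` lies in it for `a ≥ 0`, `r > 0`, so positive operators
into an Archimedean space are determined on it (`eq_of_eqOn_unitInterval`).

A homomorphism is extreme by strict convexity of squaring: contractive operators satisfy `(Sa)² ≤
S(a²)` on `[0, I]` (`map_mul_self_le_map_mul_self`), so `T = sS + tR` multiplicative forces `st(Sa -
Ra)² ≤ 0`. With no unit at hand, this Schwarz inequality comes from tangent lines of the parabola,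
averaged with Bernstein weights.

Conversely, for `a` in `[0, I]` the defect `D x = T(ax) - Ta Tx` leaves both `T ± D` contractive, so
extremality gives `D = 0`. -/

theorem IsSemiprime.mul_eq_zero_comm {A : Type*} [NonUnitalRing A] (hA : IsSemiprime A) {x y : A} (h : x * y = 0) :
    y * x = 0 := by
  apply hA
  rw [mul_assoc, ← mul_assoc x, h, zero_mul, mul_zero]

theorem mul_eq_zero_of_inf_eq_zero {A : Type*} [NonUnitalRing A] [Lattice A] [IsFAlgebra A]
    {a b : A} (h : a ⊓ b = 0) : a * b = 0 := by
  have ha : 0 ≤ a := h ▸ inf_le_left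
  have hb : 0 ≤ b := h ▸ inf_le_right
  have h1 := IsFAlgebra.mul_right_inf a b b h hb
  rw [inf_comm] at h1
  simpa using IsFAlgebra.mul_left_inf b (a * b) a h1 ha

/-! ### Disjointness and the Archimedean property -/

section VectorLattice

variable {A : Type*} [AddCommGroup A] [Lattice A] [IsOrderedAddMonoid A]

theorem posPart_sub_of_inf_eq_zero {u v : A} (h : u ⊓ v = 0) : (u - v)⁺ = u := by
  have h1 := inf_add_sup u v
  rw [h, zero_add] at h1
  have h2 : (u - v)⁺ = u ⊔ v - v := by
    rw [posPart_def, sup_sub, sub_self]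
  rw [h2, h1, add_sub_cancel_right]

/-- `n x⁺ = (n x)⁺ ≤ u`, so the Archimedean property applies to `x⁺`. -/
theorem IsArchimedean.nonpos_of_nsmul_le (hA : IsArchimedean A) {x u : A} (hu : 0 ≤ u)
    (h : ∀ n : ℕ, 0 < n → n • x ≤ u) : x ≤ 0 := by
  have h0 : x⁺ = 0 := by
    refine hA _ u (posPart_nonneg x) hu fun n => ?_
    rcases Nat.eq_zero_or_pos n with rfl | hn
    · simpa using hu
    · have e : n • x⁺ = n • x + n • x⁻ := by
        rw [← nsmul_add]; congr 1; exact (sub_eq_iff_eq_add.1 (posPart_sub_negPart x))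
      have hd : (n • x⁺) ⊓ (n • x⁻) = 0 := by
        have key : ∀ (a b : A), a ⊓ b = 0 → 0 ≤ a → 0 ≤ b → ∀ m : ℕ, (m • a) ⊓ b = 0 := by
          intro a b hab ha hb m
          induction m with
          | zero => simpa using hb
          | succ m ih =>
            refine le_antisymm ?_ (le_inf (nsmul_nonneg ha _) hb)
            set w := (m + 1) • a ⊓ b
            have hw0 : w ≤ b := inf_le_right
            have hw1 : w ≤ m • a + a := by rw [← succ_nsmul]; exact inf_le_left
            have hw2 : w - a ≤ (m • a) ⊓ b :=
              le_inf (sub_le_iff_le_add.2 hw1) ((sub_le_self _ ha).trans hw0)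
            rw [ih] at hw2
            rw [← hab]
            exact le_inf (sub_nonpos.1 hw2) hw0
        have h1 := key _ _ (posPart_inf_negPart_eq_zero x) (posPart_nonneg x) (negPart_nonneg x) n
        rw [inf_comm] at h1 ⊢
        exact key _ _ h1 (negPart_nonneg x) (nsmul_nonneg (posPart_nonneg x) _) n
      have h2 := posPart_sub_of_inf_eq_zero hd
      rw [← nsmul_sub, posPart_sub_negPart] at h2
      rw [← h2]
      exact sup_le (h n hn) hu
  exact posPart_eq_zero.1 h0

end VectorLattice

/-! ### Order and multiplication in semiprime f-algebras -/

section Ring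

variable {A : Type*} [NonUnitalRing A] [Lattice A] [IsOrderedAddMonoid A] [IsFAlgebra A]

theorem mul_le_mul_right_of_nonneg {c x y : A} (hc : 0 ≤ c) (h : x ≤ y) : x * c ≤ y * c := by
  have := IsFAlgebra.mul_nonneg' (y - x) c (sub_nonneg.2 h) hc
  rwa [sub_mul, sub_nonneg] at this

/-- Multiplication by `c` keeps `x⁺` and `x⁻` disjoint, and a disjoint decomposition is the
canonical one. -/
theorem mul_posPart {c : A} (hc : 0 ≤ c) (x : A) : c * x⁺ = (c * x)⁺ := by
  have h1 := IsFAlgebra.mul_left_inf _ _ c (posPart_inf_negPart_eq_zero x) hc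
  rw [inf_comm] at h1
  have h2 := IsFAlgebra.mul_left_inf _ _ c h1 hc
  rw [inf_comm] at h2
  rw [← posPart_sub_of_inf_eq_zero h2, ← mul_sub, posPart_sub_negPart]

theorem posPart_mul {c : A} (hc : 0 ≤ c) (x : A) : x⁺ * c = (x * c)⁺ := by
  have h1 := IsFAlgebra.mul_right_inf _ _ c (posPart_inf_negPart_eq_zero x) hc
  rw [inf_comm] at h1
  have h2 := IsFAlgebra.mul_right_inf _ _ c h1 hc
  rw [inf_comm] at h2
  rw [← posPart_sub_of_inf_eq_zero h2, ← sub_mul, posPart_sub_negPart]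

theorem posPart_mul_negPart (x : A) : x⁺ * x⁻ = 0 :=
  mul_eq_zero_of_inf_eq_zero (posPart_inf_negPart_eq_zero x)

theorem negPart_mul_posPart (x : A) : x⁻ * x⁺ = 0 :=
  mul_eq_zero_of_inf_eq_zero (by rw [inf_comm]; exact posPart_inf_negPart_eq_zero x)

theorem mul_posPart_self (x : A) : x * x⁺ = x⁺ * x⁺ := by
  have h := congrArg (· * x⁺) (posPart_sub_negPart x)
  simp only [sub_mul, negPart_mul_posPart, sub_zero] at h
  exact h.symm

theorem mul_self_nonneg' (x : A) : 0 ≤ x * x := by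
  have e : x * x = x⁺ * x⁺ + x⁻ * x⁻ := by
    conv_lhs => rw [← posPart_sub_negPart x]
    rw [mul_sub, sub_mul, sub_mul, posPart_mul_negPart, negPart_mul_posPart]
    abel
  rw [e]
  exact add_nonneg (IsFAlgebra.mul_nonneg' _ _ (posPart_nonneg x) (posPart_nonneg x))
    (IsFAlgebra.mul_nonneg' _ _ (negPart_nonneg x) (negPart_nonneg x))

theorem IsSemiprime.eq_zero_of_mul_self_nonpos (hA : IsSemiprime A) {x : A} (h : x * x ≤ 0) :
    x = 0 :=
  hA x (le_antisymm h (mul_self_nonneg' x))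

theorem IsSemiprime.nonpos_of_mul_nonpos (hA : IsSemiprime A) {x : A}
    (h : ∀ b : A, 0 ≤ b → x * b ≤ 0) : x ≤ 0 := by
  have h1 := h _ (posPart_nonneg x)
  rw [mul_posPart_self] at h1
  exact posPart_eq_zero.1 (hA.eq_zero_of_mul_self_nonpos h1)

/-- The elements of `[0, I]` act contractively by left multiplication. -/
theorem IsSemiprime.mul_le_of_mul_self_le (hA : IsSemiprime A) {c b : A} (hc : 0 ≤ c)
    (h : c * c ≤ c) (hb : 0 ≤ b) : c * b ≤ b := by
  -- The excess `d = (cb - b)⁺` is annihilated by `c` on both sides, whence `d² = d(cb - b) = -db ≤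
  -- 0`.
  have h1 : c * (c * b - b)⁺ = 0 := by
    rw [mul_posPart hc, posPart_eq_zero, mul_sub, ← mul_assoc]
    exact sub_nonpos.2 (mul_le_mul_right_of_nonneg hb h)
  have h2 := hA.mul_eq_zero_comm h1
  set d := (c * b - b)⁺ with hd
  have hd0 : 0 ≤ d := posPart_nonneg _
  have h3 : d * d = d * (c * b - b) := by
    conv_rhs => rw [← posPart_sub_negPart (c * b - b)]
    rw [← hd, mul_sub, hd, posPart_mul_negPart, sub_zero]
  rw [mul_sub, ← mul_assoc, h2, zero_mul, zero_sub] at h3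
  have h4 : d = 0 := hA.eq_zero_of_mul_self_nonpos
    (h3.le.trans (neg_nonpos.2 (IsFAlgebra.mul_nonneg' _ _ hd0 hb)))
  exact sub_nonpos.1 (posPart_eq_zero.1 h4)

theorem IsSemiprime.mul_le_of_mul_self_le' (hA : IsSemiprime A) {c b : A} (hc : 0 ≤ c)
    (h : c * c ≤ c) (hb : 0 ≤ b) : b * c ≤ b := by
  have h1 : (b * c - b)⁺ * c = 0 := by
    rw [posPart_mul hc, posPart_eq_zero, sub_mul, mul_assoc]
    exact sub_nonpos.2 (mul_le_mul_left_of_nonneg hb h)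
  have h2 := hA.mul_eq_zero_comm h1
  set d := (b * c - b)⁺ with hd
  have hd0 : 0 ≤ d := posPart_nonneg _
  have h3 : d * d = (b * c - b) * d := (mul_posPart_self _).symm
  rw [sub_mul, mul_assoc, h2, mul_zero, zero_sub] at h3
  have h4 : d = 0 := hA.eq_zero_of_mul_self_nonpos
    (h3.le.trans (neg_nonpos.2 (IsFAlgebra.mul_nonneg' _ _ hb hd0)))
  exact sub_nonpos.1 (posPart_eq_zero.1 h4)

end Ring

/-! ### The unit interval `[0, I]` -/

section Algebra

variable {A : Type*} [NonUnitalRing A] [Module ℝ A] [SMulCommClass ℝ A A]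
  [Lattice A] [IsOrderedAddMonoid A] [IsFAlgebra A]

theorem IsSemiprime.toOrth_mem_Icc_iff_forall (hA : IsSemiprime A) {a : A} :
    toOrth a ∈ Set.Icc (0 : Orth A) 1 ↔ 0 ≤ a ∧ ∀ b : A, 0 ≤ b → a * b ≤ b := by
  constructor
  · rintro ⟨h1, h2⟩
    refine ⟨?_, h2⟩
    refine neg_nonpos.1 (hA.nonpos_of_mul_nonpos fun b hb => ?_)
    rw [neg_mul, neg_nonpos]
    exact h1 b hb
  · rintro ⟨h1, h2⟩
    exact ⟨fun b hb => IsFAlgebra.mul_nonneg' _ _ h1 hb, h2⟩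

theorem IsSemiprime.toOrth_mem_Icc_iff (hA : IsSemiprime A) {a : A} :
    toOrth a ∈ Set.Icc (0 : Orth A) 1 ↔ 0 ≤ a ∧ a * a ≤ a := by
  rw [hA.toOrth_mem_Icc_iff_forall]
  exact ⟨fun h => ⟨h.1, h.2 a h.1⟩, fun h => ⟨h.1, fun b hb => hA.mul_le_of_mul_self_le h.1 h.2 hb⟩⟩

variable [IsScalarTower ℝ A A]

/-- `a² - 2ra + r²` acts positively on elements commuting with `a`. -/
theorem IsSemiprime.le_of_commute (hA : IsSemiprime A) {a f : A} (hf : 0 ≤ f)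
    (haf : a * f = f * a) (r : ℝ) :
    ((2 * r) • a - a * a) * f ≤ r ^ 2 • f := by
  set z := r ^ 2 • f - ((2 * r) • a - a * a) * f with hz
  have hz1 : z = r ^ 2 • f - (2 * r) • (a * f) + a * (a * f) := by
    rw [hz, sub_mul, smul_mul_assoc, mul_assoc]; abel
  -- Formally `z = (r - a)² f`; the second factor `f` turns this into a genuine square without a
  -- unit.
  have hzf : z * f = (r • f - a * f) * (r • f - a * f) := by
    have e : a * f * (a * f) = a * (a * f) * f := by
      rw [mul_assoc, ← mul_assoc f, ← haf, mul_assoc, mul_assoc]; simp only [← mul_assoc]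
    have e' : f * (a * f) = a * f * f := by rw [← mul_assoc, ← haf]
    rw [hz1]
    simp only [sub_mul, mul_sub, add_mul, smul_mul_assoc, mul_smul_comm, e, e', smul_smul, pow_two,
      smul_sub]
    rw [two_mul, add_smul]
    abel
  have hzf0 : 0 ≤ z * f := hzf ▸ mul_self_nonneg' _
  have h1 : z⁻ * f = 0 := by
    rw [← posPart_neg, posPart_mul hf, posPart_eq_zero, neg_mul]
    exact neg_nonpos.2 hzf0
  have h2 : f * z⁻ = 0 := hA.mul_eq_zero_comm h1
  have h3 : z * z⁻ = 0 := by
    have h5 := congrArg (· * z⁻) hz1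
    simpa only [sub_mul, add_mul, smul_mul_assoc, mul_assoc, h2, mul_zero, smul_zero, sub_zero,
      add_zero] using h5
  have h4 : z⁻ = 0 := by
    apply hA
    have h5 := congrArg (· * z⁻) (posPart_sub_negPart z)
    simp only [sub_mul, posPart_mul_negPart, h3, zero_sub, neg_eq_zero] at h5
    exact h5
  exact sub_nonneg.1 (negPart_eq_zero.1 h4)

variable [IsOrderedModule ℝ A]

/-- With `e = 2ra - a²`, formally `e ≤ r² I`, so `(e⁺)² = e e⁺ ≤ r² e⁺`. This is the source of
elements of `[0, I]`. -/
theorem smul_posPart_mul_self_le (hA : IsSemiprime A) {a : A} (ha : 0 ≤ a) {r : ℝ} (hr : 0 < r) :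
    ((r ^ 2)⁻¹ • ((2 * r) • a - a * a)⁺) * ((r ^ 2)⁻¹ • ((2 * r) • a - a * a)⁺) ≤
      (r ^ 2)⁻¹ • ((2 * r) • a - a * a)⁺ := by
  set e := (2 * r) • a - a * a with he
  have hae : a * e = e * a := by
    rw [he, mul_sub, sub_mul, mul_smul_comm, smul_mul_assoc, mul_assoc]
  have hc : a * e⁺ = e⁺ * a := by rw [mul_posPart ha, posPart_mul ha, hae]
  have h := hA.le_of_commute (posPart_nonneg e) hc r
  rw [← he, mul_posPart_self] at h
  rw [smul_mul_assoc, mul_smul_comm]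
  have hr2 : (0 : ℝ) < r ^ 2 := by positivity
  have h' := smul_le_smul_of_nonneg_left h (inv_nonneg.2 hr2.le)
  rw [smul_smul, inv_mul_cancel₀ hr2.ne', one_smul] at h'
  exact smul_le_smul_of_nonneg_left h' (inv_nonneg.2 hr2.le)

end Algebra

/-! ### Contractivity in terms of `a² ≤ a` -/

section Contractive

variable {A : Type*} [NonUnitalRing A] [Module ℝ A] [SMulCommClass ℝ A A]
  [Lattice A] [IsOrderedAddMonoid A] [IsFAlgebra A]
  {B : Type*} [NonUnitalRing B] [Module ℝ B] [SMulCommClass ℝ B B]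
  [Lattice B] [IsOrderedAddMonoid B] [IsFAlgebra B]

theorem mem_contractiveOperators_iff (hA : IsSemiprime A) (hB : IsSemiprime B) {T : A →ₗ[ℝ] B} :
    T ∈ contractiveOperators A B ↔ (∀ a, 0 ≤ a → 0 ≤ T a) ∧
      ∀ a, 0 ≤ a → a * a ≤ a → ∀ b, 0 ≤ b → T a * b ≤ b := by
  refine and_congr_right fun hT => forall_congr' fun a => ?_
  rw [hA.toOrth_mem_Icc_iff, hB.toOrth_mem_Icc_iff_forall, and_imp]
  exact ⟨fun h h1 h2 => (h h1 h2).2, fun h h1 h2 => ⟨hT a h1, h h1 h2⟩⟩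

theorem mem_contractiveOperators_of_map_mul (hA : IsSemiprime A) (hB : IsSemiprime B)
    {T : A →ₗ[ℝ] B} (hT : ∀ a, 0 ≤ a → 0 ≤ T a) (h : ∀ a b, T (a * b) = T a * T b) :
    T ∈ contractiveOperators A B := by
  refine (mem_contractiveOperators_iff hA hB).2 ⟨hT, fun a ha haa b hb => ?_⟩
  refine hB.mul_le_of_mul_self_le (hT a ha) ?_ hb
  have := hT _ (sub_nonneg.2 haa)
  rwa [map_sub, sub_nonneg, h] at this

end Contractive

/-! ### Positive operators on the unit interval -/

section Operators

variable {A : Type*} [NonUnitalRing A] [Module ℝ A] [SMulCommClass ℝ A A] [IsScalarTower ℝ A A]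
  [Lattice A] [IsOrderedAddMonoid A] [IsOrderedModule ℝ A] [IsFAlgebra A]

/-- Positive operators are determined by their values on `[0, I]`. -/
theorem eq_of_eqOn_unitInterval {E : Type*} [AddCommGroup E] [Module ℝ E] [Lattice E]
    [IsOrderedAddMonoid E] [IsOrderedModule ℝ E] (hA' : IsSemiprime A) (hE : IsArchimedean E)
    {S R : A →ₗ[ℝ] E} (hS : ∀ a, 0 ≤ a → 0 ≤ S a) (hR : ∀ a, 0 ≤ a → 0 ≤ R a)
    (h : ∀ a, 0 ≤ a → a * a ≤ a → S a = R a) : S = R := by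
  have key : ∀ S R : A →ₗ[ℝ] E, (∀ a, 0 ≤ a → 0 ≤ S a) → (∀ a, 0 ≤ a → 0 ≤ R a) →
      (∀ a, 0 ≤ a → a * a ≤ a → S a = R a) → ∀ a, 0 ≤ a → S a ≤ R a := by
    intro S R hS hR h a ha
    have haa := mul_self_nonneg' a
    refine sub_nonpos.1 (hE.nonpos_of_nsmul_le (hS _ haa) fun n hn => ?_)
    have hn' : (0 : ℝ) < n := by exact_mod_cast hn
    -- Taking `r = n/2` gives `na - a² ≤ f ≤ na`: a multiple of an element of `[0, I]` approximates
    -- `na` up to `a²`, independently of `n`.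
    set f := ((2 * ((n : ℝ) / 2)) • a - a * a)⁺ with hf
    have hr : (0 : ℝ) < (n : ℝ) / 2 := by positivity
    have hfe : S f = R f := by
      have h1 := h _ (smul_nonneg (inv_nonneg.2 (by positivity)) (posPart_nonneg _))
        (smul_posPart_mul_self_le hA' ha hr)
      rw [map_smul, map_smul] at h1
      exact smul_right_injective E (inv_ne_zero (by positivity)) h1
    have hna : (n : ℝ) • a = n • a := Nat.cast_smul_eq_nsmul ℝ n a
    have e2 : 2 * ((n : ℝ) / 2) = n := by ring
    have h1 : n • a - a * a ≤ f := by
      rw [hf, e2, hna]; exact le_posPart _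
    have h2 : f ≤ n • a := by
      rw [hf, e2, hna]; exact sup_le (sub_le_self _ haa) (nsmul_nonneg ha n)
    have h3 : 0 ≤ S (a * a - (n • a - f)) := hS _ (by
      rw [sub_nonneg]; exact sub_le_comm.1 h1)
    have h4 : 0 ≤ R (n • a - f) := hR _ (sub_nonneg.2 h2)
    rw [map_sub, map_sub, map_nsmul, sub_nonneg] at h3
    rw [map_sub, map_nsmul, sub_nonneg, ← hfe] at h4
    rw [nsmul_sub]
    exact (sub_le_sub_left h4 _).trans h3
  refine LinearMap.ext fun x => ?_
  have key' : ∀ a, 0 ≤ a → S a = R a := fun a ha =>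
    le_antisymm (key S R hS hR h a ha) (key R S hR hS (fun a h1 h2 => (h a h1 h2).symm) a ha)
  rw [← posPart_sub_negPart x, map_sub, map_sub, key' _ (posPart_nonneg x),
    key' _ (negPart_nonneg x)]

/-! ### The Schwarz inequality -/

variable {B : Type*} [NonUnitalRing B] [Module ℝ B] [SMulCommClass ℝ B B] [IsScalarTower ℝ B B]
  [Lattice B] [IsOrderedAddMonoid B] [IsOrderedModule ℝ B] [IsFAlgebra B]

/-- The tangent bound `2ra - a² ≤ r² I` passes through `S`, because `r⁻² (2ra - a²)⁺` is in `[0,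
I]`. -/
theorem map_two_smul_sub_mul_self_le (hA : IsSemiprime A) (hB : IsSemiprime B) {S : A →ₗ[ℝ] B}
    (hS : S ∈ contractiveOperators A B) {a : A} (ha : 0 ≤ a) {r : ℝ} (hr : 0 ≤ r) {b : B}
    (hb : 0 ≤ b) : 0 ≤ S (a * a) * b - (2 * r) • (S a * b) + r ^ 2 • b := by
  rw [mem_contractiveOperators_iff hA hB] at hS
  rcases hr.eq_or_lt with rfl | hr
  · simpa using IsFAlgebra.mul_nonneg' _ _ (hS.1 _ (mul_self_nonneg' a)) hb
  · have hr2 : (0 : ℝ) < r ^ 2 := by positivity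
    have h1 := hS.2 _ (smul_nonneg (inv_nonneg.2 hr2.le) (posPart_nonneg _))
      (smul_posPart_mul_self_le hA ha hr) b hb
    have h2 := smul_le_smul_of_nonneg_left h1 hr2.le
    rw [map_smul, smul_mul_assoc, smul_smul, mul_inv_cancel₀ hr2.ne', one_smul] at h2
    have h3 := hS.1 _ (sub_nonneg.2 (le_posPart ((2 * r) • a - a * a)))
    rw [map_sub, sub_nonneg, map_sub, map_smul] at h3
    have h4 := (mul_le_mul_right_of_nonneg hb h3).trans h2
    rw [sub_mul, smul_mul_assoc] at h4
    rw [← sub_nonneg] at h4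
    convert h4 using 1
    abel

open Polynomial in
theorem aeval_bernsteinPolynomial_nonneg {E : Type*} [AddCommGroup E] [Module ℝ E] [Lattice E]
    [IsOrderedAddMonoid E] {Q : Module.End ℝ E}
    (h0 : ∀ b, 0 ≤ b → 0 ≤ Q b) (h1 : ∀ b, 0 ≤ b → Q b ≤ b) (n k : ℕ) {b : E} (hb : 0 ≤ b) :
    0 ≤ aeval Q (bernsteinPolynomial ℝ n k) b := by
  have hpow : ∀ F : Module.End ℝ E, (∀ b, 0 ≤ b → 0 ≤ F b) → ∀ m : ℕ, ∀ b, 0 ≤ b →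
      0 ≤ (F ^ m) b := by
    intro F hF m
    induction m with
    | zero => intro b hb; simpa using hb
    | succ m ih => intro b hb; rw [pow_succ]; exact ih _ (hF b hb)
  have h2 : ∀ b, 0 ≤ b → 0 ≤ (1 - Q) b := fun b hb => sub_nonneg.2 (h1 b hb)
  rw [bernsteinPolynomial, mul_assoc, ← nsmul_eq_mul]
  simp only [map_nsmul, map_mul, map_pow, map_sub, map_one, aeval_X]
  exact nsmul_nonneg (hpow Q h0 k _ (hpow _ h2 _ b hb)) _

-- The Bernstein variance identity with `n²X²` removed from each square `(nX - k)²`.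
open Polynomial in
theorem bernsteinPolynomial_sum_smul (n : ℕ) :
    ∑ k ∈ Finset.range (n + 1), bernsteinPolynomial ℝ n k * ((k : ℝ[X]) ^ 2 - 2 * (n : ℝ[X]) * (k : ℝ[X]) * (X : ℝ[X])) =
      (n : ℝ[X]) * ((X : ℝ[X]) * (1 - X)) - (n : ℝ[X]) ^ 2 * (X : ℝ[X]) ^ 2 := by
  have h := bernsteinPolynomial.variance ℝ n
  have h' := bernsteinPolynomial.sum ℝ n
  have e : ∀ k ∈ Finset.range (n + 1),
      bernsteinPolynomial ℝ n k * ((k : ℝ[X]) ^ 2 - 2 * (n : ℝ[X]) * (k : ℝ[X]) * (X : ℝ[X])) =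
      (n • X - (k : ℝ[X])) ^ 2 * bernsteinPolynomial ℝ n k
        - ((n : ℝ[X]) ^ 2 * (X : ℝ[X]) ^ 2) * bernsteinPolynomial ℝ n k := by
    intro k _
    rw [nsmul_eq_mul]; ring
  rw [Finset.sum_congr rfl e, Finset.sum_sub_distrib, h, ← Finset.mul_sum, h', nsmul_eq_mul]
  ring

open Polynomial in
/-- An operator `P` dominating all tangents `2rQ - r²` of the parabola dominates `Q²`. -/
theorem apply_apply_le_of_tangent_le {E : Type*} [AddCommGroup E] [Module ℝ E] [Lattice E]
    [IsOrderedAddMonoid E] [IsOrderedModule ℝ E] (hE : IsArchimedean E) {P Q : Module.End ℝ E}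
    (h0 : ∀ b, 0 ≤ b → 0 ≤ Q b) (h1 : ∀ b, 0 ≤ b → Q b ≤ b)
    (h : ∀ r : ℝ, 0 ≤ r → ∀ b, 0 ≤ b → 0 ≤ P b - (2 * r) • Q b + r ^ 2 • b) {b : E} (hb : 0 ≤ b) :
    Q (Q b) ≤ P b := by
  refine sub_nonpos.1 (hE.nonpos_of_nsmul_le (u := Q b - Q (Q b)) (sub_nonneg.2 (h1 _ (h0 b hb)))
    fun n hn => ?_)
  have hn' : (0 : ℝ) < n := by exact_mod_cast hn
  -- The tangents at `r = k/n`, scaled by `n²` and weighted by positive operators summing to `1`,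
  -- give `n²(Q² - P) ≤ n(Q - Q²)`. The weights stand on the left, so `P` and `Q` need not commute.
  have hsum : ∑ k ∈ Finset.range (n + 1), aeval Q (bernsteinPolynomial ℝ n k) *
      ((n : ℝ) ^ 2 • P + aeval Q ((k : ℝ[X]) ^ 2 - 2 * (n : ℝ[X]) * (k : ℝ[X]) * (X : ℝ[X]))) =
      (n : ℝ) ^ 2 • P + aeval Q ((n : ℝ[X]) * ((X : ℝ[X]) * (1 - X)) - (n : ℝ[X]) ^ 2 * (X : ℝ[X]) ^ 2) := by
    simp only [mul_add, Finset.sum_add_distrib]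
    rw [← Finset.sum_mul, ← map_sum, bernsteinPolynomial.sum, map_one, one_mul,
      ← bernsteinPolynomial_sum_smul, map_sum]
    simp only [map_mul]
  have hpos : 0 ≤ ((n : ℝ) ^ 2 • P + aeval Q ((n : ℝ[X]) * ((X : ℝ[X]) * (1 - X)) - (n : ℝ[X]) ^ 2 * (X : ℝ[X]) ^ 2)) b := by
    rw [← hsum, LinearMap.sum_apply]
    refine Finset.sum_nonneg fun k _ => ?_
    rw [Module.End.mul_apply]
    refine aeval_bernsteinPolynomial_nonneg h0 h1 n k ?_
    have h2 := smul_nonneg (sq_nonneg (n : ℝ)) (h ((k : ℝ) / n) (by positivity) b hb)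
    convert h2 using 1
    have e : ((k : ℝ[X]) ^ 2 - 2 * (n : ℝ[X]) * (k : ℝ[X]) * (X : ℝ[X])) = C ((k : ℝ) ^ 2) - C (2 * n * k : ℝ) * X := by
      simp [map_ofNat]
    rw [e]
    simp only [map_sub, map_mul, aeval_C, aeval_X, LinearMap.add_apply, LinearMap.sub_apply,
      LinearMap.smul_apply, Algebra.algebraMap_eq_smul_one, smul_mul_assoc, one_mul,
      Module.End.one_apply, smul_add, smul_sub, smul_smul]
    rw [show (n : ℝ) ^ 2 * (2 * ((k : ℝ) / n)) = 2 * n * k by field_simp,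
      show (n : ℝ) ^ 2 * ((k : ℝ) / n) ^ 2 = (k : ℝ) ^ 2 by field_simp]
    abel
  have e : ((n : ℝ[X]) * ((X : ℝ[X]) * (1 - X)) - (n : ℝ[X]) ^ 2 * (X : ℝ[X]) ^ 2) =
      C (n : ℝ) * (X - X * X) - C ((n : ℝ) ^ 2) * (X * X) := by
    simp; ring
  rw [e] at hpos
  simp only [map_sub, map_mul, aeval_C, aeval_X, LinearMap.add_apply, LinearMap.sub_apply,
    LinearMap.smul_apply, Algebra.algebraMap_eq_smul_one, smul_mul_assoc, one_mul,
    Module.End.mul_apply] at hpos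
  have h3 := smul_nonneg (inv_nonneg.2 hn'.le) hpos
  rw [← Nat.cast_smul_eq_nsmul ℝ, ← sub_nonneg]
  convert h3 using 1
  match_scalars <;> field_simp

/-- Schwarz inequality for contractive operators. -/
theorem map_mul_self_le_map_mul_self (hA : IsSemiprime A) (hB' : IsArchimedean B)
    (hB : IsSemiprime B) {S : A →ₗ[ℝ] B} (hS : S ∈ contractiveOperators A B) {a : A} (ha : 0 ≤ a)
    (haa : a * a ≤ a) : S a * S a ≤ S (a * a) := by
  have hS' := (mem_contractiveOperators_iff hA hB).1 hS
  refine sub_nonpos.1 (hB.nonpos_of_mul_nonpos fun b hb => ?_)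
  rw [sub_mul, sub_nonpos, mul_assoc]
  exact apply_apply_le_of_tangent_le hB' (P := LinearMap.mulLeft ℝ (S (a * a)))
    (Q := LinearMap.mulLeft ℝ (S a))
    (fun b hb => IsFAlgebra.mul_nonneg' _ _ (hS'.1 a ha) hb) (fun b hb => hS'.2 a ha haa b hb)
    (fun r hr b hb => map_two_smul_sub_mul_self_le hA hB hS ha hr hb) hb

/-! ### Extreme points and homomorphisms -/

theorem mem_extremePoints_of_map_mul (hA : IsSemiprime A) (hB' : IsArchimedean B)
    (hB : IsSemiprime B) {T : A →ₗ[ℝ] B} (hT : ∀ a, 0 ≤ a → 0 ≤ T a)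
    (h : ∀ a b, T (a * b) = T a * T b) : T ∈ (contractiveOperators A B).extremePoints ℝ := by
  refine ⟨mem_contractiveOperators_of_map_mul hA hB hT h, ?_⟩
  rintro S hS R hR ⟨s, t, hs, ht, hst, rfl⟩
  have hSR : S = R := by
    refine eq_of_eqOn_unitInterval hA hB' hS.1 hR.1 fun a ha haa => ?_
    have h1 := smul_le_smul_of_nonneg_left (map_mul_self_le_map_mul_self hA hB' hB hS ha haa) hs.le
    have h2 := smul_le_smul_of_nonneg_left (map_mul_self_le_map_mul_self hA hB' hB hR ha haa) ht.le
    have h3 := add_le_add h1 h2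
    have h4 := h a a
    simp only [LinearMap.add_apply, LinearMap.smul_apply] at h4
    rw [h4, ← sub_nonpos] at h3
    have e : s • (S a * S a) + t • (R a * R a) - (s • S a + t • R a) * (s • S a + t • R a) =
        (s * t) • ((S a - R a) * (S a - R a)) := by
      obtain rfl : t = 1 - s := by linarith
      simp only [mul_add, add_mul, mul_sub, sub_mul, smul_mul_assoc, mul_smul_comm]
      match_scalars <;> ring
    rw [e] at h3
    have hst' : 0 < s * t := mul_pos hs ht
    have h5 := smul_nonneg (inv_nonneg.2 hst'.le) (neg_nonneg.2 h3)
    rw [smul_neg, smul_smul, inv_mul_cancel₀ hst'.ne', one_smul, neg_nonneg] at h5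
    exact sub_eq_zero.1 (hB.eq_zero_of_mul_self_nonpos h5)
  subst hSR
  rw [← add_smul, hst, one_smul]

theorem map_mul_of_mem_extremePoints (hA : IsSemiprime A) (hB' : IsArchimedean B)
    (hB : IsSemiprime B) {T : A →ₗ[ℝ] B} (h : T ∈ (contractiveOperators A B).extremePoints ℝ)
    (a x : A) : T (a * x) = T a * T x := by
  obtain ⟨hT, hext⟩ := h
  have hT' := (mem_contractiveOperators_iff hA hB).1 hT
  have bounded : ∀ a, 0 ≤ a → a * a ≤ a → ∀ x, T (a * x) = T a * T x := by
    intro a ha haa x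
    let D : A →ₗ[ℝ] B := T ∘ₗ LinearMap.mulLeft ℝ a - LinearMap.mulLeft ℝ (T a) ∘ₗ T
    have hTa := hT'.2 a ha haa
    have hTa0 := hT'.1 a ha
    have hD : ∀ x, D x = T (a * x) - T a * T x := fun x => rfl
    have hplus : T + D ∈ contractiveOperators A B := by
      refine (mem_contractiveOperators_iff hA hB).2 ⟨fun x hx => ?_, fun x hx hxx b hb => ?_⟩
      · rw [LinearMap.add_apply, hD, add_sub, add_sub_right_comm]
        exact add_nonneg (sub_nonneg.2 (hTa _ (hT'.1 x hx)))
          (hT'.1 _ (IsFAlgebra.mul_nonneg' _ _ ha hx))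
      -- `(T + D)x = (I - Ta)Tx + T(ax) ≤ (I - Ta) + Ta = I`.
      · have h1 := hT'.1 _ (sub_nonneg.2 (hA.mul_le_of_mul_self_le' hx hxx ha))
        rw [map_sub, sub_nonneg] at h1
        have h2 := hTa _ (sub_nonneg.2 (hT'.2 x hx hxx b hb))
        have h3 := mul_le_mul_right_of_nonneg hb h1
        rw [LinearMap.add_apply, hD, ← sub_nonneg]
        convert add_nonneg (sub_nonneg.2 h2) (sub_nonneg.2 h3) using 1
        noncomm_ring
    have hminus : T - D ∈ contractiveOperators A B := by
      refine (mem_contractiveOperators_iff hA hB).2 ⟨fun x hx => ?_, fun x hx hxx b hb => ?_⟩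
      · have h1 := hT'.1 _ (sub_nonneg.2 (hA.mul_le_of_mul_self_le ha haa hx))
        rw [map_sub] at h1
        rw [LinearMap.sub_apply, hD, ← sub_add]
        exact add_nonneg h1 (IsFAlgebra.mul_nonneg' _ _ hTa0 (hT'.1 x hx))
      -- `y = x + a - ax = I - (I - a)(I - x)` is in `[0, I]`, and `(T - D)x = Ty - Ta(I - Tx)`.
      · have hy0 : 0 ≤ x + a - a * x := by
          rw [add_sub_assoc]
          exact add_nonneg hx (sub_nonneg.2 (hA.mul_le_of_mul_self_le' hx hxx ha))
        have hy : ∀ c, 0 ≤ c → (x + a - a * x) * c ≤ c := by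
          intro c hc
          have h1 := hA.mul_le_of_mul_self_le ha haa
            (sub_nonneg.2 (hA.mul_le_of_mul_self_le hx hxx hc))
          rw [← sub_nonneg] at h1 ⊢
          convert h1 using 1
          noncomm_ring
        have h2 := hT'.2 _ hy0 (hy _ hy0) b hb
        rw [map_sub, map_add] at h2
        have h3 := IsFAlgebra.mul_nonneg' _ _ hTa0 (sub_nonneg.2 (hT'.2 x hx hxx b hb))
        rw [LinearMap.sub_apply, hD, ← sub_nonneg]
        convert add_nonneg (sub_nonneg.2 h2) h3 using 1
        noncomm_ring
    have hseg : T ∈ openSegment ℝ (T + D) (T - D) := by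
      refine ⟨1 / 2, 1 / 2, by norm_num, by norm_num, by norm_num, ?_⟩
      match_scalars <;> norm_num
    have hD0 : D = 0 := by simpa using hext hplus hminus hseg
    have := hD x
    rw [hD0, LinearMap.zero_apply] at this
    exact sub_eq_zero.1 this.symm
  have hpos : ∀ x, 0 ≤ x → T (a * x) = T a * T x := by
    intro x hx
    -- For fixed `x ≥ 0` both sides are positive operators in `a`, so agreement on `[0, I]`
    -- suffices.
    have := eq_of_eqOn_unitInterval hA hB' (S := T ∘ₗ LinearMap.mulRight ℝ x)
      (R := LinearMap.mulRight ℝ (T x) ∘ₗ T)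
      (fun a ha => hT'.1 _ (IsFAlgebra.mul_nonneg' _ _ ha hx))
      (fun a ha => IsFAlgebra.mul_nonneg' _ _ (hT'.1 a ha) (hT'.1 x hx))
      (fun a ha haa => bounded a ha haa x)
    exact LinearMap.congr_fun this a
  rw [← posPart_sub_negPart x, mul_sub, map_sub, map_sub, mul_sub, hpos _ (posPart_nonneg x),
    hpos _ (negPart_nonneg x)]

end Operators

end FAlg

theorem proposition3p7
    {A B : Type*}
    [NonUnitalRing A] [Module ℝ A] [IsScalarTower ℝ A A] [SMulCommClass ℝ A A]
    [Lattice A] [IsOrderedAddMonoid A] [IsOrderedModule ℝ A] [FAlg.IsFAlgebra A]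
    [NonUnitalRing B] [Module ℝ B] [IsScalarTower ℝ B B] [SMulCommClass ℝ B B]
    [Lattice B] [IsOrderedAddMonoid B] [IsOrderedModule ℝ B] [FAlg.IsFAlgebra B]
    (hA : FAlg.IsArchimedean A) (hA' : FAlg.IsSemiprime A)
    (hB : FAlg.IsArchimedean B) (hB' : FAlg.IsSemiprime B)
    (hBc : FAlg.IsRUComplete B)
    (T : A →ₗ[ℝ] B) (hT : ∀ a : A, 0 ≤ a → 0 ≤ T a) :
    (T ∈ FAlg.contractiveOperators A B ∧
      T ∈ (FAlg.contractiveOperators A B).extremePoints ℝ) ↔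
    ∀ a b : A, T (a * b) = T a * T b :=
  ⟨fun h => FAlg.map_mul_of_mem_extremePoints hA' hB hB' h.2,
    fun h => ⟨FAlg.mem_contractiveOperators_of_map_mul hA' hB' hT h,
      FAlg.mem_extremePoints_of_map_mul hA' hB hB' hT h⟩⟩
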